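/- Write points of $[0,\infty)\times\mathbb{R}^3$ as $(\eta,\mathbf{x})$, let $T>0$, and let $$\mathscr{B}_3 := L^\infty\big([0,T]^2_{(\eta_1,\eta_2)},\, L^2(\mathbb{R}^{6}_{(\mathbf{x}_1,\mathbf{x}_2)})\big),\qquad \|\chi\|_{\mathscr{B}_3} = \operatorname*{ess\,sup}_{\eta_1,\eta_2\in[0,T]} \|\chi(\eta_1,\cdot,\eta_2,\cdot)\|_{L^2}.$$ Let $a:[0,\infty)\to[0,\infty)$ be continuous with $a(0)=0$ and $a(\eta)>0$ for $\eta>0$ (the scale function of a flat FLRW universe in conformal time), let $f:([0,\infty)\times\mathbb{R}^3)^2\to\mathbb{C}$ be a bounded (Lebesgue measurable) function, let $\lambda\in\mathbb{C}$ be arbitrary, and put $$\widetilde K(\eta_1,\mathbf{x}_1,\eta_2,\mathbf{x}_2) = \frac{f(\eta_1,\mathbf{x}_1,\eta_2,\mathbf{x}_2)}{|\mathbf{x}_1-\mathbf{x}_2|}.$$ Then for every measurable $\psi^{\rm free}$ with $a(\eta_1)a(\eta_2)\psi^{\rm free}\in\mathscr{B}_3$ there is a solution $\psi$ with $a(\eta_1)a(\eta_2)\psi\in\mathscr{B}_3$,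 unique up to equality almost everywhere on $[0,T]^2\times\mathbb{R}^6$, of the integral equation $$\begin{aligned}\psi(\eta_1,\mathbf{x}_1,\eta_2,\mathbf{x}_2) ={}& \psi^{\rm free}(\eta_1,\mathbf{x}_1,\eta_2,\mathbf{x}_2) + \frac{\lambda}{(4\pi)^2}\,\frac{1}{a(\eta_1)a(\eta_2)}\int_{\mathbb{R}^3\times\mathbb{R}^3} d^3\mathbf{x}_1'\,d^3\mathbf{x}_2'\; a^2(s_1)\,a^2(s_2)\\ &\times \frac{H(s_1)}{|\mathbf{x}_1-\mathbf{x}_1'|}\,\frac{H(s_2)}{|\mathbf{x}_2-\mathbf{x}_2'|}\,\widetilde K(s_1,\mathbf{x}_1',s_2,\mathbf{x}_2')\,\psi(s_1,\mathbf{x}_1',s_2,\mathbf{x}_2'),\qquad s_i := \eta_i-|\mathbf{x}_i-\mathbf{x}_i'|,\end{aligned}$$ on $0\le\eta_1,\eta_2\le T$. Here $H$ is the Heaviside function, and being a solution means that for almost every $(\eta_1,\mathbf{x}_1,\eta_2,\mathbf{x}_2)\in[0,T]\times\mathbb{R}^3\times[0,T]\times\mathbb{R}^3$ the integral converges absolutely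 and the equation holds. -/

import Mathlib

open MeasureTheory Set
open scoped ENNReal

noncomputable section

namespace FlatFLRW

/-- Three-dimensional Euclidean space, with Lebesgue measure `volume`. -/
abbrev Space : Type := EuclideanSpace ℝ (Fin 3)

/-- A spacetime point `(η, 𝐱)` in conformal coordinates. Only `0 ≤ η` is physical: functions of
spacetime points are total functions of which only the values at times `0 ≤ η` are used. -/
abbrev Point : Type := ℝ × Space

/-- A pair `(x₁, x₂) = ((η₁, 𝐱₁), (η₂, 𝐱₂))` of spacetime points. -/
abbrev Config : Type := Point × Point

/-- Lebesgue measure on the configurations with `0 ≤ η₁` and `0 ≤ η₂`. -/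
def halfMeasure : Measure Config :=
  volume.restrict {p | 0 ≤ p.1.1 ∧ 0 ≤ p.2.1}

/-- Lebesgue measure on the configurations with `η₁, η₂ ∈ [0, T]`. -/
def slabMeasure (T : ℝ) : Measure Config :=
  volume.restrict {p | p.1.1 ∈ Icc 0 T ∧ p.2.1 ∈ Icc 0 T}

/-- The norm of `L^∞([0,T]², L²(ℝ⁶))`, with values in `[0, ∞]`:
`ess sup_{η₁, η₂ ∈ [0,T]} ‖χ(η₁, ·, η₂, ·)‖_{L²}`. -/
def bNorm (T : ℝ) (χ : Config → ℂ) : ℝ≥0∞ :=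
  essSup
    (fun t : ℝ × ℝ =>
      eLpNorm (fun y : Space × Space => χ ((t.1, y.1), (t.2, y.2))) 2 volume)
    ((volume : Measure (ℝ × ℝ)).restrict (Icc 0 T ×ˢ Icc 0 T))

/-- `χ` represents an element of `𝓑₃ = L^∞([0,T]², L²(ℝ⁶))`: it is (Lebesgue) measurable on
`[0,T]² × ℝ⁶` and has finite norm. Two such functions represent the same element exactly when
they agree `slabMeasure T`-almost everywhere. -/
def MemB (T : ℝ) (χ : Config → ℂ) : Prop :=
  AEStronglyMeasurable χ (slabMeasure T) ∧ bNorm T χ < ∞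

/-- The function `a(η₁) a(η₂) ψ(η₁, 𝐱₁, η₂, 𝐱₂)`. -/
def rescale (a : ℝ → ℝ) (ψ : Config → ℂ) : Config → ℂ :=
  fun p => (a p.1.1 : ℂ) * (a p.2.1 : ℂ) * ψ p

/-- The Heaviside function. -/
def heaviside (s : ℝ) : ℝ := if 0 ≤ s then 1 else 0

/-- The time `η - |𝐱 - 𝐲|` at which the past light cone of `x = (η, 𝐱)` meets the position `𝐲`. -/
def retardedTime (x : Point) (y : Space) : ℝ := x.1 - ‖x.2 - y‖

/-- The pair of points with positions `𝐲₁`, `𝐲₂` on the past light cones of `x₁`, `x₂`. -/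
def retardedConfig (p : Config) (y : Space × Space) : Config :=
  ((retardedTime p.1 y.1, y.1), (retardedTime p.2 y.2, y.2))

/-- The integrand, as a function of `y = (𝐱₁', 𝐱₂')`, of the multi-time integral equation on the
flat FLRW universe with scale function `a` and interaction kernel `K`: with
`sᵢ = ηᵢ - |𝐱ᵢ - 𝐱ᵢ'|` it is
`a²(s₁) a²(s₂) H(s₁)/|𝐱₁-𝐱₁'| H(s₂)/|𝐱₂-𝐱₂'| K(s₁,𝐱₁',s₂,𝐱₂') ψ(s₁,𝐱₁',s₂,𝐱₂')`. -/
def integrand (a : ℝ → ℝ) (K ψ : Config → ℂ) (p : Config) (y : Space × Space) : ℂ :=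
  ((a (retardedTime p.1 y.1) ^ 2 * a (retardedTime p.2 y.2) ^ 2
      * (heaviside (retardedTime p.1 y.1) / ‖p.1.2 - y.1‖)
      * (heaviside (retardedTime p.2 y.2) / ‖p.2.2 - y.2‖) : ℝ) : ℂ)
    * K (retardedConfig p y) * ψ (retardedConfig p y)

/-- `ψ` solves, for `0 ≤ η₁, η₂ ≤ T`, the multi-time integral equation of two massless scalar
particles on the 1+3-dimensional flat FLRW universe with scale function `a`, coupling constant
`lam` and interaction kernel `K`: for almost every configuration, the integral converges
absolutely and the equation
`ψ = ψ^free + lam / (4π)² · 1 / (a(η₁) a(η₂)) · ∫ d³𝐱₁' d³𝐱₂' (integrand)` holds. -/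
def IsSolution (T : ℝ) (a : ℝ → ℝ) (lam : ℂ) (K ψfree ψ : Config → ℂ) : Prop :=
  ∀ᵐ p ∂(slabMeasure T),
    Integrable (integrand a K ψ p) (volume : Measure (Space × Space)) ∧
    ψ p = ψfree p
      + lam / (4 * (Real.pi : ℂ)) ^ 2 * (1 / ((a p.1.1 : ℂ) * (a p.2.1 : ℂ)))
        * ∫ y : Space × Space, integrand a K ψ p y

/-- The singular kernel `f(η₁, 𝐱₁, η₂, 𝐱₂) / |𝐱₁ - 𝐱₂|`. -/
def singularKernel (f : Config → ℂ) : Config → ℂ :=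
  fun p => f p / ((‖p.1.2 - p.2.2‖ : ℝ) : ℂ)

end FlatFLRW

end

/-!
The unknown is taken to be `χ = a(η₁) a(η₂) ψ`. One of the two powers of `a(s₁) a(s₂)` in the
integrand is absorbed into `χ`, and the other, together with `f`, forms a bounded coefficient `b`
supported in the slab `0 ≤ s₁, s₂ ≤ T`. The equation becomes
`χ = χ^free + c · potential (b χ)`, where `potential u` integrates `u` over the two past light cones
against `1 / (|𝐱₁ - 𝐲₁| |𝐱₂ - 𝐲₂| |𝐲₁ - 𝐲₂|)`.

The light cones have radius at most `T`, and `|𝐲₁ - 𝐲₂|⁻²` is integrable over products of balls,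
uniformly in their centres. The Cauchy–Schwarz inequality (`sq_lintegral_kernel_mul_le`) therefore
bounds `|potential u|²` by a constant times the integral of `|u|²` over the two light cones with
weights `|𝐱₁ - 𝐲₁|⁻² |𝐱₂ - 𝐲₂|⁻²`. These weights are integrable as well, and two consequences follow
by changing variables to the spatial displacements.

* In `L²` of the slab with weight `exp (-γ (η₁ + η₂))`, the potential has norm of order `γ⁻¹`
  (`lintegral_sq_kernel_mul_weighted_le`). For large `γ` the equation is thus a fixed point equation
  for a contraction, and is uniquely solvable in `L²` (`exists_unique_volterra`). The weight is
  bounded above and below on the slab, so it does not change the space.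
* At fixed `η₁, η₂`, the `L²` norm of the potential over the positions is bounded by the `L²` norm of
  `u` over the slab (`lintegral_sq_potential_fixed_time_le`). Hence the `L²` solution is in `𝓑₃` if the
  free term is.

Since `𝓑₃` is contained in `L²` of the slab, uniqueness in `𝓑₃` follows from uniqueness in `L²`.
-/

noncomputable section

namespace FlatFLRW

/-! ### Integrals over past light cones -/

/-- The area of the unit sphere of `Space`. -/
def sphereArea : ℝ≥0∞ := (volume : Measure Space).toSphere univ

lemma sphereArea_ne_top : sphereArea ≠ ∞ := measure_ne_top _ _

/-- Integration in polar coordinates, for functions with values in `[0, ∞]`. -/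
lemma lintegral_fun_norm {g : ℝ → ℝ≥0∞} (hg : Measurable g) :
    ∫⁻ x : Space, g ‖x‖ = sphereArea * ∫⁻ r in Ioi (0 : ℝ), ENNReal.ofReal (r ^ 2) * g r := by
  have hdim : Module.finrank ℝ Space - 1 = 2 := by simp
  calc
    ∫⁻ x : Space, g ‖x‖
      = ∫⁻ x : ({(0)}ᶜ : Set Space), g ‖x.1‖ ∂((volume : Measure Space).comap (↑)) := by
        rw [lintegral_subtype_comap (measurableSet_singleton _).compl fun x ↦ g ‖x‖,
          restrict_compl_singleton]
    _ = ∫⁻ x, g x.2 ∂(volume : Measure Space).toSphere.prod (.volumeIoiPow 2) := by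
        rw [← hdim]
        simpa using (volume : Measure Space).measurePreserving_homeomorphUnitSphereProd.lintegral_comp
          (f := g ∘ Subtype.val ∘ Prod.snd) (by fun_prop)
    _ = sphereArea * ∫⁻ x : Ioi (0 : ℝ), g x ∂.volumeIoiPow 2 := by
        rw [lintegral_prod _ (by fun_prop)]
        simp [sphereArea, mul_comm]
    _ = _ := by
        rw [Measure.volumeIoiPow, lintegral_withDensity_eq_lintegral_mul _ (by fun_prop)
          (by fun_prop), ← lintegral_subtype_comap measurableSet_Ioi]
        rfl

/-- The weight `|z|⁻²`. -/
def invSq (z : Space) : ℝ≥0∞ := (‖z‖ₑ ^ 2)⁻¹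

@[fun_prop]
lemma measurable_invSq : Measurable invSq := by unfold invSq; fun_prop

/-- In three dimensions the weight `|z|⁻²` cancels the Jacobian `r²` of polar coordinates. -/
lemma lintegral_invSq_mul {g : ℝ → ℝ≥0∞} (hg : Measurable g) :
    ∫⁻ z : Space, invSq z * g ‖z‖ = sphereArea * ∫⁻ r in Ioi (0 : ℝ), g r := by
  have h := lintegral_fun_norm (g := fun r => (ENNReal.ofReal r ^ 2)⁻¹ * g r) (by fun_prop)
  simp only [ofReal_norm] at h
  rw [show (∫⁻ z : Space, invSq z * g ‖z‖) = _ from h]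
  congr 1
  refine setLIntegral_congr_fun measurableSet_Ioi fun r hr => ?_
  have hr' : ENNReal.ofReal r ≠ 0 := by simpa using hr
  rw [← mul_assoc, ENNReal.ofReal_pow (le_of_lt hr),
    ENNReal.mul_inv_cancel (pow_ne_zero _ hr') (by simp), one_mul]

lemma lintegral_invSq_mul_exp {γ : ℝ} (hγ : 0 < γ) :
    ∫⁻ z : Space, invSq z * ENNReal.ofReal (Real.exp (-(γ * ‖z‖)))
      = sphereArea * ENNReal.ofReal γ⁻¹ := by
  rw [lintegral_invSq_mul (g := fun r => ENNReal.ofReal (Real.exp (-(γ * r)))) (by fun_prop)]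
  have h1 : IntegrableOn (fun r => Real.exp (-(γ * r))) (Ioi 0) := by
    simpa using integrableOn_exp_mul_Ioi (a := -γ) (by linarith) 0
  have h2 : ∫ r in Ioi (0 : ℝ), Real.exp (-(γ * r)) = γ⁻¹ := by
    have := integral_exp_mul_Ioi (a := -γ) (by linarith) 0
    simpa using this
  rw [← ofReal_integral_eq_lintegral_ofReal h1 (.of_forall fun _ => (Real.exp_pos _).le), h2]

lemma lintegral_invSq_mul_sub_le {g : ℝ → ℝ≥0∞} (hg : Measurable g) (η : ℝ) :
    ∫⁻ z : Space, invSq z * g (η - ‖z‖) ≤ sphereArea * ∫⁻ s, g s := by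
  rw [lintegral_invSq_mul (g := fun r => g (η - r)) (by fun_prop)]
  refine mul_le_mul_right ?_ _
  exact (setLIntegral_le_lintegral _ _).trans (lintegral_sub_left_eq_self (μ := volume) g η).le

lemma lintegral_lintegral_sub {G : Space → Space → ℝ≥0∞} (hG : Measurable (Function.uncurry G)) :
    ∫⁻ x : Space, ∫⁻ y : Space, G (x - y) y = ∫⁻ z : Space, ∫⁻ y : Space, G z y := by
  rw [lintegral_lintegral_swap (by fun_prop)]
  simp_rw [fun y => lintegral_sub_right_eq_self (μ := volume) (fun z => G z y) y]
  rw [lintegral_lintegral_swap (by fun_prop)]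

/-- Integrating a function over all past light cones, with a weight `k` in the spatial displacement:
for a fixed displacement, passing to the retarded point is a translation of spacetime, so the
integral factorizes. -/
lemma lintegral_retarded (k : Space → ℝ≥0∞) (hk : Measurable k) {F : Point → ℝ≥0∞}
    (hF : Measurable F) :
    ∫⁻ p : Point, ∫⁻ y : Space, k (p.2 - y) * F (retardedTime p y, y)
      = (∫⁻ z, k z) * ∫⁻ q, F q := by
  unfold retardedTime
  rw [Measure.volume_eq_prod, lintegral_prod _ (by fun_prop)]
  simp only
  simp_rw [fun η : ℝ => lintegral_lintegral_sub (G := fun z y => k z * F (η - ‖z‖, y)) (by fun_prop)]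
  rw [lintegral_lintegral_swap (by fun_prop), ← lintegral_mul_const _ hk]
  refine lintegral_congr fun z => ?_
  rw [lintegral_prod _ (by fun_prop)]
  simp_rw [fun a => lintegral_const_mul (μ := volume) (k z) (f := fun y => F (a - ‖z‖, y)) (by fun_prop)]
  rw [lintegral_const_mul _ (by fun_prop),
    lintegral_sub_right_eq_self (fun s => ∫⁻ y, F (s, y)) ‖z‖]

/-- For vertices at one fixed time `η`, the weight `|z|⁻²` distributes the retarded times uniformly
over the past of `η`, so that the integral over vertices and cones is a spacetime integral. -/
lemma lintegral_retarded_fixed_time_le {F : Point → ℝ≥0∞} (hF : Measurable F) (η : ℝ) :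
    ∫⁻ x : Space, ∫⁻ y : Space, invSq (x - y) * F (η - ‖x - y‖, y)
      ≤ sphereArea * ∫⁻ q, F q := by
  rw [lintegral_lintegral_sub (G := fun z y => invSq z * F (η - ‖z‖, y)) (by fun_prop),
    Measure.volume_eq_prod, lintegral_prod _ (by fun_prop)]
  simp_rw [fun z : Space => lintegral_const_mul (μ := volume) (invSq z)
    (f := fun y => F (η - ‖z‖, y)) (by fun_prop)]
  exact lintegral_invSq_mul_sub_le (g := fun s => ∫⁻ y, F (s, y)) (by fun_prop) η

@[fun_prop]
lemma measurable_retardedConfig {α : Type*} [MeasurableSpace α] {f : α → Config}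
    {g : α → Space × Space} (hf : Measurable f) (hg : Measurable g) :
    Measurable fun a => retardedConfig (f a) (g a) := by
  unfold retardedConfig retardedTime
  fun_prop

/-- The two-particle version of `lintegral_retarded`, obtained by applying it to each particle. -/
lemma lintegral_retardedConfig (k : Space → ℝ≥0∞) (hk : Measurable k) {F : Config → ℝ≥0∞}
    (hF : Measurable F) :
    ∫⁻ p : Config, ∫⁻ y : Space × Space,
        k (p.1.2 - y.1) * k (p.2.2 - y.2) * F (retardedConfig p y)
      = (∫⁻ z, k z) ^ 2 * ∫⁻ q, F q := by
  calc
    _ = ∫⁻ p₁ : Point, ∫⁻ y₁ : Space, k (p₁.2 - y₁) *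
          ∫⁻ p₂ : Point, ∫⁻ y₂ : Space, k (p₂.2 - y₂) *
            F ((retardedTime p₁ y₁, y₁), (retardedTime p₂ y₂, y₂)) := by
        unfold retardedConfig retardedTime
        rw [Measure.volume_eq_prod Point Point, Measure.volume_eq_prod Space Space,
          lintegral_prod _ (by fun_prop)]
        refine lintegral_congr fun p₁ => ?_
        refine (lintegral_congr fun p₂ => lintegral_prod _ (by fun_prop)).trans ?_
        rw [lintegral_lintegral_swap (by fun_prop)]
        refine lintegral_congr fun y₁ => ?_
        rw [← lintegral_const_mul _ (by fun_prop)]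
        refine lintegral_congr fun p₂ => ?_
        rw [← lintegral_const_mul _ (by fun_prop)]
        simp only [mul_assoc]
    _ = ∫⁻ p₁ : Point, ∫⁻ y₁ : Space, k (p₁.2 - y₁) *
          ((∫⁻ z, k z) * ∫⁻ q₂, F ((retardedTime p₁ y₁, y₁), q₂)) := by
        simp_rw [fun q₁ => lintegral_retarded k hk (F := fun q₂ => F (q₁, q₂)) (by fun_prop)]
    _ = _ := by
        rw [lintegral_retarded k hk (F := fun q₁ => (∫⁻ z, k z) * ∫⁻ q₂, F (q₁, q₂)) (by fun_prop),
          lintegral_const_mul _ (by fun_prop), sq, mul_assoc, Measure.volume_eq_prod Point Point,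
          lintegral_prod _ (by fun_prop)]

/-- The two-particle version of `lintegral_retarded_fixed_time_le`. -/
lemma lintegral_retardedConfig_fixed_time_le {F : Config → ℝ≥0∞} (hF : Measurable F) (t : ℝ × ℝ) :
    ∫⁻ x : Space × Space, ∫⁻ y : Space × Space,
        invSq (x.1 - y.1) * invSq (x.2 - y.2) * F (retardedConfig ((t.1, x.1), (t.2, x.2)) y)
      ≤ sphereArea ^ 2 * ∫⁻ q, F q := by
  calc
    _ = ∫⁻ x₁ : Space, ∫⁻ y₁ : Space, invSq (x₁ - y₁) *
          ∫⁻ x₂ : Space, ∫⁻ y₂ : Space, invSq (x₂ - y₂) *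
            F ((t.1 - ‖x₁ - y₁‖, y₁), (t.2 - ‖x₂ - y₂‖, y₂)) := by
        unfold retardedConfig retardedTime
        rw [Measure.volume_eq_prod Space Space, lintegral_prod _ (by fun_prop)]
        refine lintegral_congr fun p₁ => ?_
        refine (lintegral_congr fun p₂ => lintegral_prod _ (by fun_prop)).trans ?_
        rw [lintegral_lintegral_swap (by fun_prop)]
        refine lintegral_congr fun y₁ => ?_
        rw [← lintegral_const_mul _ (by fun_prop)]
        refine lintegral_congr fun p₂ => ?_
        rw [← lintegral_const_mul _ (by fun_prop)]
        simp only [mul_assoc]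
    _ ≤ ∫⁻ x₁ : Space, ∫⁻ y₁ : Space, invSq (x₁ - y₁) *
          (sphereArea * ∫⁻ q₂, F ((t.1 - ‖x₁ - y₁‖, y₁), q₂)) := by
        gcongr with x₁ y₁
        exact lintegral_retarded_fixed_time_le
          (F := fun q₂ => F ((t.1 - ‖x₁ - y₁‖, y₁), q₂)) (by fun_prop) t.2
    _ ≤ sphereArea * ∫⁻ q₁, sphereArea * ∫⁻ q₂, F (q₁, q₂) :=
        lintegral_retarded_fixed_time_le
          (F := fun q₁ => sphereArea * ∫⁻ q₂, F (q₁, q₂)) (by fun_prop) t.1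
    _ = _ := by
        rw [lintegral_const_mul _ (by fun_prop), sq, mul_assoc, Measure.volume_eq_prod Point Point,
          lintegral_prod _ (by fun_prop)]

/-- Almost everywhere statements are inherited by points on past light cones. -/
lemma ae_ae_retardedConfig {P : Config → Prop} (h : ∀ᵐ q, P q) :
    ∀ᵐ p : Config, ∀ᵐ y : Space × Space, P (retardedConfig p y) := by
  obtain ⟨N, hN, hNm, hN0⟩ := exists_measurable_superset_of_null h
  -- With the constant weight the formula reads `∞ * 0 = 0`, which is the convention in `[0, ∞]`.
  have h0 := lintegral_retardedConfig (fun _ => 1) measurable_const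
    (F := N.indicator 1) (measurable_one.indicator hNm)
  have hm : Measurable (Function.uncurry fun (p : Config) (y : Space × Space) =>
      N.indicator (1 : Config → ℝ≥0∞) (retardedConfig p y)) := by
    exact (measurable_one.indicator hNm).comp (by fun_prop)
  simp only [lintegral_indicator_one hNm, hN0, mul_zero, one_mul] at h0
  rw [lintegral_eq_zero_iff hm.lintegral_prod_right] at h0
  filter_upwards [h0] with p hp
  have hmp : Measurable fun y => N.indicator (1 : Config → ℝ≥0∞) (retardedConfig p y) :=
    hm.comp (measurable_prodMk_left (x := p))
  rw [Pi.zero_apply, lintegral_eq_zero_iff hmp] at hp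
  filter_upwards [hp] with y hy
  by_contra hc
  have : retardedConfig p y ∈ N := hN hc
  simp [this] at hy

/-- Separating the times from the positions preserves Lebesgue measure. -/
lemma measurePreserving_config :
    MeasurePreserving (fun q : (ℝ × ℝ) × (Space × Space) =>
      (((q.1.1, q.2.1), (q.1.2, q.2.2)) : Config)) := by
  refine ⟨by fun_prop, Measure.ext_of_lintegral _ fun F hF => ?_⟩
  rw [lintegral_map hF (by fun_prop)]
  simp only [Measure.volume_eq_prod]
  rw [lintegral_prod _ (by fun_prop), lintegral_prod _ (by fun_prop),
    lintegral_prod _ (by fun_prop), lintegral_prod _ (by fun_prop)]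
  refine lintegral_congr fun t₁ => ?_
  refine (lintegral_congr fun t₂ => lintegral_prod _ (by fun_prop)).trans ?_
  rw [lintegral_lintegral_swap (by fun_prop)]
  refine lintegral_congr fun x₁ => ?_
  rw [lintegral_prod _ (by fun_prop)]

/-! ### The retarded potential -/

/-- The configurations with `η₁, η₂ ∈ [0, T]`. -/
def slab (T : ℝ) : Set Config := {p | p.1.1 ∈ Icc 0 T ∧ p.2.1 ∈ Icc 0 T}

lemma measurableSet_slab (T : ℝ) : MeasurableSet (slab T) :=
  (measurableSet_Icc.preimage (by fun_prop : Measurable fun p : Config => p.1.1)).inter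
    (measurableSet_Icc.preimage (by fun_prop : Measurable fun p : Config => p.2.1))

/-- The singular factor `1 / (|𝐱₁ - 𝐲₁| |𝐱₂ - 𝐲₂| |𝐲₁ - 𝐲₂|)` of the integral equation. -/
def kernel (p : Config) (y : Space × Space) : ℝ :=
  (‖p.1.2 - y.1‖ * ‖p.2.2 - y.2‖ * ‖y.1 - y.2‖)⁻¹

/-- The retarded potential of `u`: the integral of `u` over the two past light cones against
`kernel`. -/
def potential (u : Config → ℂ) (p : Config) : ℂ :=
  ∫ y : Space × Space, (kernel p y : ℂ) * u (retardedConfig p y)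

/-- Only an inequality, because at coinciding positions the left-hand side has the value `0` and the
right-hand side the value `∞`. -/
lemma enorm_kernel_le (p : Config) (y : Space × Space) :
    ‖(kernel p y : ℂ)‖ₑ ≤ ‖y.1 - y.2‖ₑ⁻¹ * (‖p.1.2 - y.1‖ₑ⁻¹ * ‖p.2.2 - y.2‖ₑ⁻¹) := by
  unfold kernel
  by_cases h : ‖p.1.2 - y.1‖ * ‖p.2.2 - y.2‖ * ‖y.1 - y.2‖ = 0
  · simp [h]
  · simp only [mul_eq_zero, not_or] at h
    have h1 : 0 < ‖p.1.2 - y.1‖ := lt_of_le_of_ne (norm_nonneg _) (Ne.symm h.1.1)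
    have h2 : 0 < ‖p.2.2 - y.2‖ := lt_of_le_of_ne (norm_nonneg _) (Ne.symm h.1.2)
    have h3 : 0 < ‖y.1 - y.2‖ := lt_of_le_of_ne (norm_nonneg _) (Ne.symm h.2)
    rw [← ofReal_norm, Complex.norm_real, norm_inv, Real.norm_of_nonneg (by positivity),
      ENNReal.ofReal_inv_of_pos (by positivity), ENNReal.ofReal_mul (by positivity),
      ENNReal.ofReal_mul (by positivity), ofReal_norm, ofReal_norm, ofReal_norm,
      ENNReal.mul_inv (.inr enorm_ne_top) (.inl (ENNReal.mul_ne_top enorm_ne_top enorm_ne_top)),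
      ENNReal.mul_inv (.inr enorm_ne_top) (.inl enorm_ne_top), mul_comm]

/-- An upper bound for the integral of `|𝐲₁ - 𝐲₂|⁻²` over a product of two balls of radius `T`. -/
def pairBound (T : ℝ) : ℝ≥0∞ :=
  (sphereArea + volume (Metric.closedBall (0 : Space) T)) * volume (Metric.closedBall (0 : Space) T)

lemma pairBound_ne_top (T : ℝ) : pairBound T ≠ ∞ := by
  have := (measure_closedBall_lt_top (μ := (volume : Measure Space)) (x := 0) (r := T)).ne
  exact ENNReal.mul_ne_top (ENNReal.add_ne_top.2 ⟨sphereArea_ne_top, this⟩) this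

/-- Uniformity in `w`: `|y - w|⁻²` is integrable near its singularity, and at most `1` outside the
unit ball around `w`. -/
lemma setLIntegral_invSq_le (T : ℝ) (x w : Space) :
    ∫⁻ y in Metric.closedBall x T, invSq (y - w)
      ≤ sphereArea + volume (Metric.closedBall (0 : Space) T) := by
  have h1 : ∀ z : Space, invSq z ≤ invSq z * (Iio 1).indicator 1 ‖z‖ + 1 := by
    intro z
    by_cases hz : ‖z‖ < 1
    · simp [hz]
    · have : (1 : ℝ≥0∞) ≤ ‖z‖ₑ := by
        rw [← ofReal_norm]
        exact ENNReal.one_le_ofReal.2 (not_lt.1 hz)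
      refine le_add_left ?_
      simpa [invSq] using one_le_pow₀ this
  have hm : Measurable ((Iio 1).indicator 1 : ℝ → ℝ≥0∞) := measurable_one.indicator measurableSet_Iio
  calc
    _ ≤ ∫⁻ y in Metric.closedBall x T, (invSq (y - w) * (Iio 1).indicator 1 ‖y - w‖ + 1) := by
        gcongr; exact h1 _
    _ = (∫⁻ y in Metric.closedBall x T, invSq (y - w) * (Iio 1).indicator 1 ‖y - w‖)
          + volume (Metric.closedBall x T) := by
        rw [lintegral_add_right _ measurable_const]; simp
    _ ≤ (∫⁻ y, invSq (y - w) * (Iio 1).indicator 1 ‖y - w‖) + volume (Metric.closedBall x T) := by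
        exact add_le_add (setLIntegral_le_lintegral _ _) le_rfl
    _ = _ := by
        rw [lintegral_sub_right_eq_self (μ := (volume : Measure Space))
          (fun z => invSq z * (Iio 1).indicator 1 ‖z‖) w, lintegral_invSq_mul hm,
          lintegral_indicator_one measurableSet_Iio, Measure.restrict_apply measurableSet_Iio,
          Iio_inter_Ioi, Real.volume_Ioo, Measure.addHaar_closedBall_center]
        simp

lemma setLIntegral_invSq_prod_le (T : ℝ) (x : Space × Space) :
    ∫⁻ y in Metric.closedBall x.1 T ×ˢ Metric.closedBall x.2 T, invSq (y.1 - y.2)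
      ≤ pairBound T := by
  rw [Measure.volume_eq_prod, ← Measure.prod_restrict, lintegral_prod_symm' _ (by fun_prop)]
  calc
    _ ≤ ∫⁻ _ in Metric.closedBall x.2 T, (sphereArea + volume (Metric.closedBall (0 : Space) T)) := by
        gcongr; exact setLIntegral_invSq_le _ _ _
    _ = _ := by simp [pairBound, Measure.addHaar_closedBall_center (volume : Measure Space) x.2]

/-- The pointwise Cauchy–Schwarz estimate. The factor `|𝐲₁ - 𝐲₂|⁻¹` is separated from
`|𝐱₁ - 𝐲₁|⁻¹ |𝐱₂ - 𝐲₂|⁻¹ u`, and each of the two is square integrable over the past light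
cones, which have radius at most `T`. -/
lemma sq_lintegral_kernel_mul_le {T : ℝ} {u : Config → ℂ} (hu : Measurable u)
    (hu0 : ∀ q ∉ slab T, u q = 0) {p : Config} (hp : p ∈ slab T) :
    (∫⁻ y : Space × Space, ‖(kernel p y : ℂ) * u (retardedConfig p y)‖ₑ) ^ 2
      ≤ pairBound T * ∫⁻ y : Space × Space,
          invSq (p.1.2 - y.1) * invSq (p.2.2 - y.2) * ‖u (retardedConfig p y)‖ₑ ^ 2 := by
  set B : Set (Space × Space) := Metric.closedBall p.1.2 T ×ˢ Metric.closedBall p.2.2 T with hB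
  have hBm : MeasurableSet B := measurableSet_closedBall.prod measurableSet_closedBall
  -- Retarded points in the slab have nonnegative times, so the displacement is at most `ηᵢ ≤ T`.
  have hsupp : ∀ y ∉ B, u (retardedConfig p y) = 0 := by
    intro y hy
    refine hu0 _ fun hq => hy ?_
    have h1 : 0 ≤ p.1.1 - ‖p.1.2 - y.1‖ := hq.1.1
    have h2 : 0 ≤ p.2.1 - ‖p.2.2 - y.2‖ := hq.2.1
    have h3 := hp.1.2
    have h4 := hp.2.2
    constructor
    · rw [Metric.mem_closedBall, dist_comm, dist_eq_norm]; linarith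
    · rw [Metric.mem_closedBall, dist_comm, dist_eq_norm]; linarith
  set F : Space × Space → ℝ≥0∞ := B.indicator fun y => ‖y.1 - y.2‖ₑ⁻¹
  set G : Space × Space → ℝ≥0∞ := fun y =>
    ‖p.1.2 - y.1‖ₑ⁻¹ * ‖p.2.2 - y.2‖ₑ⁻¹ * ‖u (retardedConfig p y)‖ₑ
  have hF : AEMeasurable F := by
    refine Measurable.aemeasurable (Measurable.indicator ?_ hBm); fun_prop
  have hG : AEMeasurable G := by fun_prop
  have hle : ∀ y, ‖(kernel p y : ℂ) * u (retardedConfig p y)‖ₑ ≤ (F * G) y := by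
    intro y
    by_cases hy : y ∈ B
    · simp only [enorm_mul, Pi.mul_apply, F, G, indicator_of_mem hy]
      rw [← mul_assoc]
      gcongr
      exact enorm_kernel_le p y
    · simp [hsupp y hy]
  have hHol := ENNReal.lintegral_mul_le_Lp_mul_Lq volume Real.HolderConjugate.two_two hF hG
  have hF2 : ∫⁻ y, F y ^ (2 : ℝ) ≤ pairBound T := by
    refine le_trans (le_of_eq ?_) (setLIntegral_invSq_prod_le T (p.1.2, p.2.2))
    rw [← lintegral_indicator hBm]
    refine lintegral_congr fun y => ?_
    by_cases hy : y ∈ B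
    · rw [indicator_of_mem (by exact hy)]
      simp [F, hy, invSq, ENNReal.inv_pow]
    · rw [indicator_of_notMem (by exact hy)]
      simp [F, hy]
  have hG2 : ∫⁻ y, G y ^ (2 : ℝ) = ∫⁻ y : Space × Space,
      invSq (p.1.2 - y.1) * invSq (p.2.2 - y.2) * ‖u (retardedConfig p y)‖ₑ ^ 2 := by
    refine lintegral_congr fun y => ?_
    simp [G, invSq, mul_pow, ENNReal.inv_pow]
  calc
    _ ≤ ((∫⁻ y, F y ^ (2 : ℝ)) ^ (1 / 2 : ℝ) * (∫⁻ y, G y ^ (2 : ℝ)) ^ (1 / 2 : ℝ)) ^ 2 := by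
        gcongr
        exact (lintegral_mono hle).trans hHol
    _ = (∫⁻ y, F y ^ (2 : ℝ)) * ∫⁻ y, G y ^ (2 : ℝ) := by
        rw [mul_pow]
        congr 1 <;> rw [← ENNReal.rpow_natCast, ← ENNReal.rpow_mul] <;> norm_num
    _ ≤ _ := by rw [hG2]; gcongr

lemma enorm_potential_le (u : Config → ℂ) (p : Config) :
    ‖potential u p‖ₑ ≤ ∫⁻ y : Space × Space, ‖(kernel p y : ℂ) * u (retardedConfig p y)‖ₑ :=
  enorm_integral_le_lintegral_enorm _

lemma potential_congr_ae {u v : Config → ℂ} (h : u =ᵐ[volume] v) :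
    potential u =ᵐ[volume] potential v := by
  filter_upwards [ae_ae_retardedConfig h] with p hp
  refine integral_congr_ae ?_
  filter_upwards [hp] with y hy
  rw [hy]

lemma measurable_kernel_mul {u : Config → ℂ} (hu : Measurable u) :
    Measurable (Function.uncurry fun (p : Config) (y : Space × Space) =>
      (kernel p y : ℂ) * u (retardedConfig p y)) := by
  unfold kernel
  fun_prop

/-- The potential depends on `u` only up to null sets (`potential_congr_ae`), so estimates of it may
be proved for Borel measurable functions that vanish exactly off the slab. -/
lemma exists_measurable_eq_zero_off_slab {T : ℝ} {u : Config → ℂ}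
    (hu : AEStronglyMeasurable u volume) (hu0 : ∀ q ∉ slab T, u q = 0) :
    ∃ v : Config → ℂ, Measurable v ∧ (∀ q ∉ slab T, v q = 0) ∧ u =ᵐ[volume] v := by
  refine ⟨(slab T).indicator (hu.mk u),
    hu.stronglyMeasurable_mk.measurable.indicator (measurableSet_slab T),
    fun q hq => indicator_of_notMem hq _, ?_⟩
  filter_upwards [hu.ae_eq_mk] with q hq
  by_cases h : q ∈ slab T
  · simp [h, hq]
  · simp [h, hu0 q h]

lemma aestronglyMeasurable_potential {u : Config → ℂ} (hu : AEStronglyMeasurable u volume) :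
    AEStronglyMeasurable (potential u) volume := by
  refine AEStronglyMeasurable.congr ?_ (potential_congr_ae hu.ae_eq_mk).symm
  exact (measurable_kernel_mul
    hu.stronglyMeasurable_mk.measurable).stronglyMeasurable.integral_prod_right.aestronglyMeasurable

/-- Lebesgue measure on the slab with the weight `exp (-γ (η₁ + η₂))`. For large `γ` the retarded
potential is a contraction of the `L²` space of this measure. -/
def weightedMeasure (T γ : ℝ) : Measure Config :=
  (slabMeasure T).withDensity fun p => ENNReal.ofReal (Real.exp (-(γ * (p.1.1 + p.2.1))))

lemma lintegral_weightedMeasure (T γ : ℝ) (F : Config → ℝ≥0∞) :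
    ∫⁻ p, F p ∂weightedMeasure T γ
      = ∫⁻ p in slab T, ENNReal.ofReal (Real.exp (-(γ * (p.1.1 + p.2.1)))) * F p := by
  rw [weightedMeasure, lintegral_withDensity_eq_lintegral_mul_non_measurable _ (by fun_prop)
    (by simp)]
  rfl

lemma ae_weightedMeasure_iff {T γ : ℝ} {P : Config → Prop} :
    (∀ᵐ p ∂weightedMeasure T γ, P p) ↔ ∀ᵐ p ∂slabMeasure T, P p :=
  ⟨fun h => (withDensity_absolutelyContinuous' (by fun_prop)
    (.of_forall fun p => by simpa using Real.exp_pos _)).ae_le h,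
   fun h => (withDensity_absolutelyContinuous _ _).ae_le h⟩

/-- The weighted `L²` estimate. As `ηᵢ = sᵢ + |𝐱ᵢ - 𝐲ᵢ|`, the weight `exp (-γ (η₁ + η₂))` at the
vertices is the weight at the retarded points times `exp (-γ |𝐱₁ - 𝐲₁|) exp (-γ |𝐱₂ - 𝐲₂|)`, and
the latter makes the integral of `|z|⁻²` of order `γ⁻¹` for each particle. -/
lemma lintegral_sq_kernel_mul_weighted_le {T γ : ℝ} (hγ : 0 < γ) {u : Config → ℂ}
    (hu : AEStronglyMeasurable u volume) (hu0 : ∀ q ∉ slab T, u q = 0) :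
    ∫⁻ p, (∫⁻ y : Space × Space, ‖(kernel p y : ℂ) * u (retardedConfig p y)‖ₑ) ^ 2
        ∂weightedMeasure T γ
      ≤ pairBound T * (sphereArea * ENNReal.ofReal γ⁻¹) ^ 2 *
          ∫⁻ q, ‖u q‖ₑ ^ 2 ∂weightedMeasure T γ := by
  wlog hm : Measurable u generalizing u
  · obtain ⟨v, hv, hv0, huv⟩ := exists_measurable_eq_zero_off_slab hu hu0
    have huv' : u =ᵐ[weightedMeasure T γ] v := ae_weightedMeasure_iff.2 (ae_restrict_of_ae huv)
    have h := this hv.aestronglyMeasurable hv0 hv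
    have hnorm : ∫⁻ q, ‖u q‖ₑ ^ 2 ∂weightedMeasure T γ = ∫⁻ q, ‖v q‖ₑ ^ 2 ∂weightedMeasure T γ :=
      lintegral_congr_ae (huv'.mono fun q hq => by simp only [hq])
    rw [hnorm]
    refine le_trans (le_of_eq (lintegral_congr_ae ?_)) h
    refine ae_weightedMeasure_iff.2 (ae_restrict_of_ae ?_)
    filter_upwards [ae_ae_retardedConfig huv] with p hp
    congr 1
    exact lintegral_congr_ae (hp.mono fun y hy => by simp only [hy])
  set e : ℝ → ℝ≥0∞ := fun s => ENNReal.ofReal (Real.exp (-(γ * s))) with he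
  have hem : Measurable e := by fun_prop
  have he_add : ∀ s t, e (s + t) = e s * e t := fun s t => by
    simp only [he]
    rw [← ENNReal.ofReal_mul (Real.exp_pos _).le, ← Real.exp_add]
    congr 2; ring
  set k : Space → ℝ≥0∞ := fun z => invSq z * e ‖z‖
  have hk : Measurable k := by fun_prop
  set F : Config → ℝ≥0∞ := fun q => e (q.1.1 + q.2.1) * ‖u q‖ₑ ^ 2
  have hF : Measurable F := by fun_prop
  calc
    _ = ∫⁻ p in slab T, e (p.1.1 + p.2.1) *
          (∫⁻ y : Space × Space, ‖(kernel p y : ℂ) * u (retardedConfig p y)‖ₑ) ^ 2 :=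
        lintegral_weightedMeasure ..
    _ ≤ ∫⁻ p in slab T, pairBound T * ∫⁻ y : Space × Space,
          k (p.1.2 - y.1) * k (p.2.2 - y.2) * F (retardedConfig p y) := by
        refine setLIntegral_mono' (measurableSet_slab T) fun p hp => ?_
        refine (mul_le_mul_right (sq_lintegral_kernel_mul_le hm hu0 hp) _).trans_eq ?_
        rw [mul_left_comm, ← lintegral_const_mul _ (by fun_prop)]
        congr 1
        refine lintegral_congr fun y => ?_
        have : p.1.1 + p.2.1 = ‖p.1.2 - y.1‖ + (‖p.2.2 - y.2‖ +
            ((retardedConfig p y).1.1 + (retardedConfig p y).2.1)) := by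
          simp only [retardedConfig, retardedTime]; ring
        rw [this, he_add, he_add]
        simp only [k, F]
        ring
    _ ≤ ∫⁻ p, pairBound T * ∫⁻ y : Space × Space,
          k (p.1.2 - y.1) * k (p.2.2 - y.2) * F (retardedConfig p y) :=
        setLIntegral_le_lintegral _ _
    _ = pairBound T * ((∫⁻ z, k z) ^ 2 * ∫⁻ q, F q) := by
        rw [lintegral_const_mul _ (by fun_prop), lintegral_retardedConfig k hk hF]
    _ = _ := by
        rw [lintegral_invSq_mul_exp hγ, lintegral_weightedMeasure, mul_assoc,
          setLIntegral_eq_of_support_subset]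
        intro q hq
        by_contra h
        simp [hu0 q h] at hq

/-- The gain in regularity: the potential of a function in `L²` of the slab is bounded in `L²` of the
positions, uniformly in the two times. -/
lemma lintegral_sq_potential_fixed_time_le {T : ℝ} {u : Config → ℂ} (hu : Measurable u)
    (hu0 : ∀ q ∉ slab T, u q = 0) {t : ℝ × ℝ} (ht : t ∈ Icc 0 T ×ˢ Icc 0 T) :
    ∫⁻ x : Space × Space, ‖potential u ((t.1, x.1), (t.2, x.2))‖ₑ ^ 2
      ≤ pairBound T * (sphereArea ^ 2 * ∫⁻ q, ‖u q‖ₑ ^ 2) := by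
  calc
    _ ≤ ∫⁻ x : Space × Space, pairBound T * ∫⁻ y : Space × Space, invSq (x.1 - y.1) *
          invSq (x.2 - y.2) * ‖u (retardedConfig ((t.1, x.1), (t.2, x.2)) y)‖ₑ ^ 2 := by
        gcongr with x
        refine le_trans ?_ (sq_lintegral_kernel_mul_le hu hu0
          (p := ((t.1, x.1), (t.2, x.2))) ⟨ht.1, ht.2⟩)
        gcongr
        exact enorm_potential_le _ _
    _ ≤ _ := by
        rw [lintegral_const_mul _ (by fun_prop)]
        gcongr
        exact lintegral_retardedConfig_fixed_time_le (F := fun q => ‖u q‖ₑ ^ 2) (by fun_prop) t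

/-! ### Unique solvability in `L²` of the slab -/

lemma sq_eLpNorm_two {α : Type*} [MeasurableSpace α] (μ : Measure α) (u : α → ℂ) :
    eLpNorm u 2 μ ^ 2 = ∫⁻ x, ‖u x‖ₑ ^ 2 ∂μ := by
  have := eLpNorm_nnreal_pow_eq_lintegral (f := u) (μ := μ) (p := 2) (by norm_num)
  simpa using this

/-- The Banach fixed point theorem for an affine equation `χ = g + V χ` in `L²`, with `V` acting on
functions rather than on their equivalence classes. -/
theorem exists_unique_ae_eq_add {α : Type*} [MeasurableSpace α] {μ : Measure α}
    (V : (α → ℂ) → α → ℂ)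
    (hcongr : ∀ u v, u =ᵐ[μ] v → V u =ᵐ[μ] V v)
    (hmem : ∀ u, MemLp u 2 μ → MemLp (V u) 2 μ)
    (hsub : ∀ u v, MemLp u 2 μ → MemLp v 2 μ → V u - V v =ᵐ[μ] V (u - v))
    (hle : ∀ u, MemLp u 2 μ → eLpNorm (V u) 2 μ ≤ 2⁻¹ * eLpNorm u 2 μ)
    {g : α → ℂ} (hg : MemLp g 2 μ) :
    ∃ χ, MemLp χ 2 μ ∧ χ =ᵐ[μ] g + V χ ∧
      ∀ χ', MemLp χ' 2 μ → χ' =ᵐ[μ] g + V χ' → χ' =ᵐ[μ] χ := by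
  set Φ : Lp ℂ 2 μ → Lp ℂ 2 μ := fun u => (hg.add (hmem u (Lp.memLp u))).toLp (g + V u) with hΦ
  have hΦc : ContractingWith (2⁻¹ : NNReal) Φ := by
    refine ⟨by norm_num, fun u v => ?_⟩
    rw [Lp.edist_def, Lp.edist_def]
    have h1 : (Φ u : α → ℂ) - (Φ v : α → ℂ) =ᵐ[μ] V ((u : α → ℂ) - (v : α → ℂ)) := by
      filter_upwards [(hg.add (hmem u (Lp.memLp u))).coeFn_toLp,
        (hg.add (hmem v (Lp.memLp v))).coeFn_toLp, hsub u v (Lp.memLp u) (Lp.memLp v)]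
        with x hu hv hs
      rw [← hs, Pi.sub_apply, hu, hv]
      simp
    rw [eLpNorm_congr_ae h1]
    simpa using hle _ ((Lp.memLp u).sub (Lp.memLp v))
  refine ⟨hΦc.fixedPoint, Lp.memLp _, ?_, fun χ' hχ' heq => ?_⟩
  · have h := (hg.add (hmem _ (Lp.memLp hΦc.fixedPoint))).coeFn_toLp
    have hfix : (hg.add (hmem _ (Lp.memLp hΦc.fixedPoint))).toLp _ = hΦc.fixedPoint :=
      hΦc.fixedPoint_isFixedPt
    rwa [hfix] at h
  · have hc : (hχ'.toLp χ' : α → ℂ) =ᵐ[μ] χ' := hχ'.coeFn_toLp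
    have hfix : Φ (hχ'.toLp χ') = hχ'.toLp χ' := by
      refine Lp.ext ?_
      filter_upwards [(hg.add (hmem _ (Lp.memLp (hχ'.toLp χ')))).coeFn_toLp, heq, hc,
        hcongr _ _ hc] with x h1 h2 h3 h4
      rw [h1, h3, h2, Pi.add_apply, Pi.add_apply, h4]
    rw [← hΦc.fixedPoint_unique hfix]
    exact hc.symm

lemma weightedMeasure_le {T γ : ℝ} (hγ : 0 < γ) : weightedMeasure T γ ≤ slabMeasure T := by
  rw [weightedMeasure]
  nth_rw 2 [← withDensity_one (μ := slabMeasure T)]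
  refine withDensity_mono ?_
  filter_upwards [ae_restrict_mem (measurableSet_slab T)] with p hp
  have h1 := hp.1.1
  have h2 := hp.2.1
  simp only [Pi.one_apply, ENNReal.ofReal_le_one, Real.exp_le_one_iff]
  have : 0 ≤ γ * (p.1.1 + p.2.1) := by positivity
  linarith

lemma slabMeasure_le_smul {T γ : ℝ} (hγ : 0 < γ) :
    slabMeasure T ≤ ENNReal.ofReal (Real.exp (γ * (T + T))) • weightedMeasure T γ := by
  rw [weightedMeasure, ← withDensity_smul _ (by fun_prop)]
  nth_rw 1 [← withDensity_one (μ := slabMeasure T)]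
  refine withDensity_mono ?_
  filter_upwards [ae_restrict_mem (measurableSet_slab T)] with p hp
  have h1 := hp.1.2
  have h2 := hp.2.2
  rw [Pi.one_apply, Pi.smul_apply, smul_eq_mul, ← ENNReal.ofReal_mul (Real.exp_pos _).le,
    ← Real.exp_add, ENNReal.one_le_ofReal, Real.one_le_exp_iff, ← sub_eq_add_neg, ← mul_sub]
  exact mul_nonneg hγ.le (by linarith)

lemma memLp_weightedMeasure_iff {T γ : ℝ} (hγ : 0 < γ) {u : Config → ℂ} :
    MemLp u 2 (weightedMeasure T γ) ↔ MemLp u 2 (slabMeasure T) :=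
  ⟨fun h => h.of_measure_le_smul ENNReal.ofReal_ne_top (slabMeasure_le_smul hγ),
   fun h => h.mono_measure (weightedMeasure_le hγ)⟩

lemma ae_integrable_kernel_mul {T : ℝ} {u : Config → ℂ} (hu : MemLp u 2 volume)
    (hu0 : ∀ q ∉ slab T, u q = 0) :
    ∀ᵐ p ∂slabMeasure T, Integrable fun y : Space × Space =>
      (kernel p y : ℂ) * u (retardedConfig p y) := by
  obtain ⟨v, hv, hv0, huv⟩ := exists_measurable_eq_zero_off_slab hu.1 hu0
  have hfin : ∫⁻ q, ‖v q‖ₑ ^ 2 ∂weightedMeasure T 1 ≠ ∞ := by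
    rw [← sq_eLpNorm_two]
    exact ENNReal.pow_ne_top ((memLp_weightedMeasure_iff one_pos).2
      ((hu.ae_eq huv).restrict (slab T))).2.ne
  have h := lintegral_sq_kernel_mul_weighted_le (T := T) one_pos hv.aestronglyMeasurable hv0
  have hlt := ae_lt_top (((measurable_kernel_mul hv).enorm.lintegral_prod_right').pow_const 2)
    (ne_top_of_le_ne_top (ENNReal.mul_ne_top (ENNReal.mul_ne_top (pairBound_ne_top T)
      (ENNReal.pow_ne_top (ENNReal.mul_ne_top sphereArea_ne_top ENNReal.ofReal_ne_top))) hfin) h)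
  filter_upwards [ae_weightedMeasure_iff.1 hlt, ae_restrict_of_ae (ae_ae_retardedConfig huv)]
    with p hp hpv
  have hvi : Integrable fun y : Space × Space => (kernel p y : ℂ) * v (retardedConfig p y) :=
    ⟨((measurable_kernel_mul hv).comp measurable_prodMk_left).aestronglyMeasurable, 
      hasFiniteIntegral_iff_enorm.2 (by simpa only [ENNReal.pow_lt_top_iff, OfNat.ofNat_ne_zero,
        or_false, Function.uncurry_apply_pair] using hp)⟩
  exact hvi.congr (hpv.mono fun y hy => by simp only [hy])

section Volterra

variable {T M : ℝ} {b : Config → ℂ}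

lemma memLp_mul_of_bounded (hb : AEStronglyMeasurable b volume) (hb0 : ∀ q ∉ slab T, b q = 0)
    (hbM : ∀ q, ‖b q‖ ≤ M) {χ : Config → ℂ} (hχ : MemLp χ 2 (slabMeasure T)) :
    MemLp (fun q => b q * χ q) 2 volume := by
  have h : MemLp (fun q => b q * χ q) 2 (slabMeasure T) :=
    (hχ.const_mul (M : ℂ)).of_le (hb.restrict.mul hχ.1) (.of_forall fun q => by
      rw [norm_mul, norm_mul]
      gcongr
      exact (hbM q).trans (by simpa using le_abs_self M))
  rw [← Set.indicator_eq_self (s := slab T) (f := fun q => b q * χ q) |>.2]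
  · exact (memLp_indicator_iff_restrict (measurableSet_slab T)).2 h
  · intro q hq
    by_contra hc
    simp [hb0 q hc] at hq

/-- The linear Volterra equation `χ = g + c · potential (b χ)` with a bounded coefficient `b` is
uniquely solvable in `L²` of the slab. -/
theorem exists_unique_volterra (hb : AEStronglyMeasurable b volume)
    (hb0 : ∀ q ∉ slab T, b q = 0) (hbM : ∀ q, ‖b q‖ ≤ M) (c : ℂ) {g : Config → ℂ}
    (hg : MemLp g 2 (slabMeasure T)) :
    ∃ χ, MemLp χ 2 (slabMeasure T) ∧
      (∀ᵐ p ∂slabMeasure T, χ p = g p + c * potential (fun q => b q * χ q) p) ∧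
      ∀ χ', MemLp χ' 2 (slabMeasure T) →
        (∀ᵐ p ∂slabMeasure T, χ' p = g p + c * potential (fun q => b q * χ' q) p) →
        χ' =ᵐ[slabMeasure T] χ := by
  set R : ℝ≥0∞ := ‖c‖ₑ ^ 2 * (pairBound T * sphereArea ^ 2) * ENNReal.ofReal M ^ 2 with hR
  have hRtop : R ≠ ∞ := by
    refine ENNReal.mul_ne_top (ENNReal.mul_ne_top (ENNReal.pow_ne_top enorm_ne_top)
      (ENNReal.mul_ne_top (pairBound_ne_top T) (ENNReal.pow_ne_top sphereArea_ne_top)))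
      (ENNReal.pow_ne_top ENNReal.ofReal_ne_top)
  set γ : ℝ := 2 * (R.toReal + 1) with hγdef
  have hr : 0 ≤ R.toReal := ENNReal.toReal_nonneg
  have hγ : 0 < γ := by positivity
  -- With `r = R.toReal` this is `r / (2 (r + 1)) ^ 2 ≤ 1 / 4`.
  have hRγ : R * ENNReal.ofReal γ⁻¹ ^ 2 ≤ 2⁻¹ ^ 2 := by
    rw [← ENNReal.ofReal_toReal hRtop, ← ENNReal.ofReal_pow (by positivity),
      ← ENNReal.ofReal_mul hr, ← ENNReal.ofReal_ofNat, ← ENNReal.ofReal_inv_of_pos (by norm_num),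
      ← ENNReal.ofReal_pow (by norm_num)]
    refine ENNReal.ofReal_le_ofReal ?_
    rw [hγdef, inv_pow, ← div_eq_mul_inv, div_le_iff₀ (by positivity)]
    nlinarith
  set μ := weightedMeasure T γ with hμ
  have hmul0 : ∀ χ : Config → ℂ, ∀ q ∉ slab T, b q * χ q = 0 := fun χ q hq => by simp [hb0 q hq]
  have hbound : ∀ χ, MemLp χ 2 μ →
      eLpNorm (fun p => c * potential (fun q => b q * χ q) p) 2 μ ≤ 2⁻¹ * eLpNorm χ 2 μ := by
    intro χ hχ
    have hbχ := memLp_mul_of_bounded hb hb0 hbM ((memLp_weightedMeasure_iff hγ).1 hχ)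
    rw [← ENNReal.pow_le_pow_left_iff two_ne_zero, mul_pow, sq_eLpNorm_two, sq_eLpNorm_two]
    calc
      _ = ‖c‖ₑ ^ 2 * ∫⁻ p, ‖potential (fun q => b q * χ q) p‖ₑ ^ 2 ∂μ := by
          simp_rw [enorm_mul, mul_pow]
          rw [lintegral_const_mul' _ _ (ENNReal.pow_ne_top enorm_ne_top)]
      _ ≤ ‖c‖ₑ ^ 2 * (pairBound T * (sphereArea * ENNReal.ofReal γ⁻¹) ^ 2 *
            ∫⁻ q, ‖b q * χ q‖ₑ ^ 2 ∂μ) := by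
          gcongr
          refine le_trans ?_ (lintegral_sq_kernel_mul_weighted_le hγ hbχ.1 (hmul0 χ))
          gcongr
          exact enorm_potential_le _ _
      _ ≤ ‖c‖ₑ ^ 2 * (pairBound T * (sphereArea * ENNReal.ofReal γ⁻¹) ^ 2 *
            (ENNReal.ofReal M ^ 2 * ∫⁻ q, ‖χ q‖ₑ ^ 2 ∂μ)) := by
          rw [← lintegral_const_mul' _ _ (ENNReal.pow_ne_top ENNReal.ofReal_ne_top)]
          gcongr with q
          rw [enorm_mul, mul_pow]
          gcongr
          rw [← ofReal_norm]
          exact ENNReal.ofReal_le_ofReal (hbM q)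
      _ = R * ENNReal.ofReal γ⁻¹ ^ 2 * ∫⁻ q, ‖χ q‖ₑ ^ 2 ∂μ := by rw [hR]; ring
      _ ≤ _ := by gcongr
  obtain ⟨χ, hχ, heq, huniq⟩ := exists_unique_ae_eq_add (μ := μ)
    (fun χ p => c * potential (fun q => b q * χ q) p)
    (by
      intro u v huv
      have h : (fun q => b q * u q) =ᵐ[volume] fun q => b q * v q := by
        have h' := (ae_restrict_iff' (measurableSet_slab T)).1 (ae_weightedMeasure_iff.1 huv)
        filter_upwards [h'] with q hq
        by_cases hqs : q ∈ slab T
        · rw [hq hqs]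
        · rw [hmul0 u q hqs, hmul0 v q hqs]
      refine ae_weightedMeasure_iff.2 (ae_restrict_of_ae ?_)
      filter_upwards [potential_congr_ae h] with p hp
      rw [hp])
    (by
      intro u hu
      have hbu := memLp_mul_of_bounded hb hb0 hbM ((memLp_weightedMeasure_iff hγ).1 hu)
      refine ⟨((aestronglyMeasurable_potential hbu.1).const_mul c).mono_ac ?_,
        (hbound u hu).trans_lt (ENNReal.mul_lt_top (by simp) hu.2)⟩
      exact (withDensity_absolutelyContinuous _ _).trans Measure.absolutelyContinuous_restrict)
    (by
      intro u v hu hv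
      have hbu := memLp_mul_of_bounded hb hb0 hbM ((memLp_weightedMeasure_iff hγ).1 hu)
      have hbv := memLp_mul_of_bounded hb hb0 hbM ((memLp_weightedMeasure_iff hγ).1 hv)
      refine ae_weightedMeasure_iff.2 ?_
      filter_upwards [ae_integrable_kernel_mul hbu (hmul0 u),
        ae_integrable_kernel_mul hbv (hmul0 v)] with p hpu hpv
      rw [Pi.sub_apply, ← mul_sub]
      congr 1
      simp only [potential]
      rw [← integral_sub hpu hpv]
      refine integral_congr_ae (.of_forall fun y => ?_)
      simp only [Pi.sub_apply]
      ring)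
    hbound ((memLp_weightedMeasure_iff hγ).2 hg)
  refine ⟨χ, (memLp_weightedMeasure_iff hγ).1 hχ, ae_weightedMeasure_iff.1 heq,
    fun χ' hχ' h' => ae_weightedMeasure_iff.1
      (huniq χ' ((memLp_weightedMeasure_iff hγ).2 hχ') (ae_weightedMeasure_iff.2 h'))⟩

end Volterra

/-! ### The space `𝓑₃` -/

lemma measurePreserving_slab (T : ℝ) :
    MeasurePreserving (fun q : (ℝ × ℝ) × (Space × Space) =>
      (((q.1.1, q.2.1), (q.1.2, q.2.2)) : Config))
      (((volume : Measure (ℝ × ℝ)).restrict (Icc 0 T ×ˢ Icc 0 T)).prod volume) (slabMeasure T) := by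
  have h := measurePreserving_config.restrict_preimage (measurableSet_slab T)
  have hs : (fun q : (ℝ × ℝ) × (Space × Space) =>
      (((q.1.1, q.2.1), (q.1.2, q.2.2)) : Config)) ⁻¹' slab T
      = (Icc 0 T ×ˢ Icc 0 T) ×ˢ univ := by
    ext q; exact ⟨fun h => ⟨h, trivial⟩, fun h => h.1⟩
  rw [hs, Measure.volume_eq_prod (ℝ × ℝ), ← Measure.prod_restrict, Measure.restrict_univ] at h
  exact h

lemma ae_ae_of_ae_slabMeasure {T : ℝ} {P : Config → Prop} (h : ∀ᵐ p ∂slabMeasure T, P p) :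
    ∀ᵐ t : ℝ × ℝ ∂volume.restrict (Icc 0 T ×ˢ Icc 0 T), ∀ᵐ x : Space × Space,
      P ((t.1, x.1), (t.2, x.2)) :=
  Measure.ae_ae_of_ae_prod ((measurePreserving_slab T).quasiMeasurePreserving.ae h)

lemma memB_congr {T : ℝ} {χ χ' : Config → ℂ} (hχ : MemB T χ) (h : χ =ᵐ[slabMeasure T] χ') :
    MemB T χ' := by
  refine ⟨hχ.1.congr h, ?_⟩
  have : bNorm T χ = bNorm T χ' :=
    essSup_congr_ae ((ae_ae_of_ae_slabMeasure h).mono fun t ht => eLpNorm_congr_ae ht)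
  exact this ▸ hχ.2

/-- Membership in `𝓑₃` in terms of `[0, ∞]`-valued integrals over the positions. -/
lemma memB_iff {T : ℝ} {χ : Config → ℂ} :
    MemB T χ ↔ AEStronglyMeasurable χ (slabMeasure T) ∧
      ∃ C : ℝ≥0∞, C ≠ ∞ ∧ ∀ᵐ t : ℝ × ℝ ∂volume.restrict (Icc 0 T ×ˢ Icc 0 T),
        ∫⁻ x : Space × Space, ‖χ ((t.1, x.1), (t.2, x.2))‖ₑ ^ 2 ≤ C := by
  refine and_congr_right fun _ => ⟨fun h => ⟨bNorm T χ ^ 2, ENNReal.pow_ne_top h.ne, ?_⟩, ?_⟩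
  · filter_upwards [ENNReal.ae_le_essSup _] with t ht
    rw [← sq_eLpNorm_two volume fun x : Space × Space => χ ((t.1, x.1), (t.2, x.2))]
    exact pow_le_pow_left₀ zero_le ht 2
  · rintro ⟨C, hC, h⟩
    -- The maximum with `1` ensures that a number above the bound is at most its square.
    refine (essSup_le_of_ae_le (max C 1) ?_).trans_lt (by simpa using hC.lt_top)
    filter_upwards [h] with t ht
    rw [← sq_eLpNorm_two volume fun x : Space × Space => χ ((t.1, x.1), (t.2, x.2))] at ht
    by_contra! hlt
    have h1 := (le_max_right C 1).trans hlt.le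
    exact absurd ((le_self_pow h1 two_ne_zero).trans ht) (not_le.2 ((le_max_left C 1).trans_lt hlt))

/-- As the time interval is bounded, `𝓑₃` is contained in `L²` of the slab. -/
lemma MemB.memLp {T : ℝ} {χ : Config → ℂ} (hχ : MemB T χ) : MemLp χ 2 (slabMeasure T) := by
  obtain ⟨hm, C, hC, hle⟩ := memB_iff.1 hχ
  refine ⟨hm, ?_⟩
  suffices h : eLpNorm χ 2 (slabMeasure T) ^ 2 < ∞ by simpa [ENNReal.pow_lt_top_iff] using h
  have hm' : AEStronglyMeasurable χ (Measure.map _ _) :=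
    (measurePreserving_slab T).map_eq.symm ▸ hm
  rw [sq_eLpNorm_two, ← (measurePreserving_slab T).map_eq,
    lintegral_map' (hm'.enorm.pow_const 2) (by fun_prop), lintegral_prod _ (by
      exact (hm'.enorm.pow_const 2).comp_measurable (by fun_prop))]
  refine (lintegral_mono_ae hle).trans_lt ?_
  rw [setLIntegral_const, Measure.volume_eq_prod, Measure.prod_prod, Real.volume_Icc]
  exact ENNReal.mul_lt_top hC.lt_top (ENNReal.mul_lt_top (by simp) (by simp))

/-- By `lintegral_sq_potential_fixed_time_le`, an `L²` solution with free term in `𝓑₃` is in `𝓑₃`. -/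
lemma memB_add_potential {T : ℝ} {g u : Config → ℂ} (hg : MemB T g) (hu : MemLp u 2 volume)
    (hu0 : ∀ q ∉ slab T, u q = 0) (c : ℂ) :
    MemB T fun p => g p + c * potential u p := by
  obtain ⟨hgm, C, hC, hle⟩ := memB_iff.1 hg
  obtain ⟨v, hv, hv0, huv⟩ := exists_measurable_eq_zero_off_slab hu.1 hu0
  have hfin : ∫⁻ q, ‖v q‖ₑ ^ 2 ≠ ∞ := by
    rw [← sq_eLpNorm_two]
    exact ENNReal.pow_ne_top (hu.ae_eq huv).2.ne
  refine memB_iff.2 ⟨hgm.add ((aestronglyMeasurable_potential hu.1).const_mul c).restrict,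
    2 * (C + ‖c‖ₑ ^ 2 * (pairBound T * (sphereArea ^ 2 * ∫⁻ q, ‖v q‖ₑ ^ 2))), ?_, ?_⟩
  · refine ENNReal.mul_ne_top (by simp) (ENNReal.add_ne_top.2 ⟨hC, ?_⟩)
    exact ENNReal.mul_ne_top (ENNReal.pow_ne_top enorm_ne_top)
      (ENNReal.mul_ne_top (pairBound_ne_top T)
        (ENNReal.mul_ne_top (ENNReal.pow_ne_top sphereArea_ne_top) hfin))
  have hpot : potential u =ᵐ[slabMeasure T] potential v :=
    ae_restrict_of_ae (potential_congr_ae huv)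
  filter_upwards [hle, ae_ae_of_ae_slabMeasure hpot,
    ae_restrict_mem (measurableSet_Icc.prod measurableSet_Icc)] with t ht hpt htT
  have hvm : Measurable (potential v) :=
    (measurable_kernel_mul hv).stronglyMeasurable.integral_prod_right.measurable
  calc
    _ ≤ ∫⁻ x : Space × Space, 2 * (‖g ((t.1, x.1), (t.2, x.2))‖ₑ ^ 2 +
          ‖c‖ₑ ^ 2 * ‖potential v ((t.1, x.1), (t.2, x.2))‖ₑ ^ 2) := by
        refine lintegral_mono_ae (hpt.mono fun x hx => ?_)
        rw [hx, ← mul_pow, ← enorm_mul]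
        refine (pow_le_pow_left₀ zero_le (enorm_add_le _ _) 2).trans ?_
        have h := ENNReal.rpow_add_le_mul_rpow_add_rpow
          ‖g ((t.1, x.1), (t.2, x.2))‖ₑ ‖c * potential v ((t.1, x.1), (t.2, x.2))‖ₑ
          (p := 2) (by norm_num)
        norm_num at h
        simpa using h
    _ = 2 * ((∫⁻ x : Space × Space, ‖g ((t.1, x.1), (t.2, x.2))‖ₑ ^ 2) +
          ‖c‖ₑ ^ 2 * ∫⁻ x : Space × Space, ‖potential v ((t.1, x.1), (t.2, x.2))‖ₑ ^ 2) := by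
        rw [lintegral_const_mul' _ _ (by simp), lintegral_add_right _ (by fun_prop),
          lintegral_const_mul _ (by fun_prop)]
    _ ≤ _ := by
        gcongr
        exact lintegral_sq_potential_fixed_time_le hv hv0 htT

/-! ### The integral equation on the flat FLRW universe -/

/-- The bounded part `a(η₁) a(η₂) f` of the integral kernel, on the slab. -/
def coefficient (T : ℝ) (a : ℝ → ℝ) (f : Config → ℂ) : Config → ℂ :=
  (slab T).indicator fun q => (a q.1.1 : ℂ) * (a q.2.1 : ℂ) * f q

lemma coefficient_eq_zero {T : ℝ} {a : ℝ → ℝ} {f : Config → ℂ} : ∀ q ∉ slab T,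
    coefficient T a f q = 0 := fun _ hq => indicator_of_notMem hq _

lemma aestronglyMeasurable_coefficient (T : ℝ) {a : ℝ → ℝ} (ha : ContinuousOn a (Ici 0))
    {f : Config → ℂ} (hf : AEStronglyMeasurable f halfMeasure) :
    AEStronglyMeasurable (coefficient T a f) volume := by
  refine (aestronglyMeasurable_indicator_iff (measurableSet_slab T)).2 ?_
  have hf' : AEStronglyMeasurable f (volume.restrict (slab T)) :=
    hf.mono_measure (Measure.restrict_mono
      (show slab T ⊆ {q : Config | 0 ≤ q.1.1 ∧ 0 ≤ q.2.1} from fun _ hq => ⟨hq.1.1, hq.2.1⟩) le_rfl)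
  -- `a` is only continuous on `[0, ∞)`, and need not be measurable elsewhere.
  have ha' : Continuous fun s => a (max s 0) :=
    ha.comp_continuous (by fun_prop) fun s => le_max_right s 0
  have h : AEStronglyMeasurable (fun q : Config =>
      (a (max q.1.1 0) : ℂ) * (a (max q.2.1 0) : ℂ) * f q) (volume.restrict (slab T)) := by
    refine AEStronglyMeasurable.mul (Continuous.aestronglyMeasurable ?_) hf'
    exact (Complex.continuous_ofReal.comp (ha'.comp (by fun_prop))).mul
      (Complex.continuous_ofReal.comp (ha'.comp (by fun_prop)))
  refine h.congr ?_
  filter_upwards [ae_restrict_mem (measurableSet_slab T)] with q hq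
  rw [max_eq_left hq.1.1, max_eq_left hq.2.1]

lemma exists_norm_coefficient_le (T : ℝ) {a : ℝ → ℝ} (ha : ContinuousOn a (Ici 0))
    {f : Config → ℂ} (hf : ∃ C : ℝ, ∀ p : Config, 0 ≤ p.1.1 → 0 ≤ p.2.1 → ‖f p‖ ≤ C) :
    ∃ M : ℝ, ∀ q, ‖coefficient T a f q‖ ≤ M := by
  obtain ⟨C, hC⟩ := hf
  obtain ⟨A, hA⟩ := isCompact_Icc.exists_bound_of_continuousOn
    (ha.mono (Icc_subset_Ici_self : Icc 0 T ⊆ Ici 0))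
  refine ⟨|A| * |A| * |C|, fun q => ?_⟩
  by_cases hq : q ∈ slab T
  · rw [coefficient, indicator_of_mem hq, norm_mul, norm_mul, Complex.norm_real, Complex.norm_real]
    gcongr
    · exact (hA _ hq.1).trans (le_abs_self A)
    · exact (hA _ hq.2).trans (le_abs_self A)
    · exact (hC q hq.1.1 hq.2.1).trans (le_abs_self C)
  · rw [coefficient_eq_zero q hq, norm_zero]
    positivity

/-- In terms of `rescale a ψ` the integrand has the bounded coefficient `a(s₁) a(s₂) f`: of the factor
`a²(s₁) a²(s₂)`, one power is used to rescale `ψ`. The Heaviside functions restrict the retarded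
points to the slab. -/
lemma integrand_eq {T : ℝ} (a : ℝ → ℝ) (f ψ : Config → ℂ) {p : Config} (hp : p ∈ slab T)
    (y : Space × Space) :
    integrand a (singularKernel f) ψ p y = (kernel p y : ℂ) *
      (coefficient T a f (retardedConfig p y) * rescale a ψ (retardedConfig p y)) := by
  have h1 : retardedTime p.1 y.1 ≤ T := (sub_le_self _ (norm_nonneg _)).trans hp.1.2
  have h2 : retardedTime p.2 y.2 ≤ T := (sub_le_self _ (norm_nonneg _)).trans hp.2.2
  by_cases hs : 0 ≤ retardedTime p.1 y.1 ∧ 0 ≤ retardedTime p.2 y.2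
  · have hq : retardedConfig p y ∈ slab T := ⟨⟨hs.1, h1⟩, ⟨hs.2, h2⟩⟩
    rw [coefficient, indicator_of_mem hq]
    simp only [integrand, heaviside, if_pos hs.1, if_pos hs.2, singularKernel, rescale,
      kernel, retardedConfig]
    push_cast
    simp only [div_eq_mul_inv, mul_inv]
    ring
  · have hq : retardedConfig p y ∉ slab T := fun hq => hs ⟨hq.1.1, hq.2.1⟩
    have hH : heaviside (retardedTime p.1 y.1) = 0 ∨ heaviside (retardedTime p.2 y.2) = 0 := by
      simpa [heaviside, imp_iff_not_or, not_and_or] using hs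
    rw [coefficient_eq_zero _ hq]
    rcases hH with h | h <;> simp [integrand, h]

lemma ae_times_ne_zero : ∀ᵐ p : Config, p.1.1 ≠ 0 ∧ p.2.1 ≠ 0 := by
  have h0 : ∀ᵐ s : ℝ, s ≠ 0 := Measure.ae_ne volume 0
  have hP : ∀ᵐ x : Point, x.1 ≠ 0 := Measure.quasiMeasurePreserving_fst.ae h0
  exact (Measure.quasiMeasurePreserving_fst.ae hP).and (Measure.quasiMeasurePreserving_snd.ae hP)

lemma ae_scale_ne_zero (T : ℝ) {a : ℝ → ℝ} (ha : ∀ η, 0 < η → 0 < a η) :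
    ∀ᵐ p ∂slabMeasure T, (a p.1.1 : ℂ) ≠ 0 ∧ (a p.2.1 : ℂ) ≠ 0 := by
  filter_upwards [ae_restrict_of_ae ae_times_ne_zero, ae_restrict_mem (measurableSet_slab T)]
    with p hp hpT
  exact ⟨Complex.ofReal_ne_zero.2 (ha _ (lt_of_le_of_ne hpT.1.1 hp.1.symm)).ne',
    Complex.ofReal_ne_zero.2 (ha _ (lt_of_le_of_ne hpT.2.1 hp.2.symm)).ne'⟩

/-- The integral equation for `ψ` is the Volterra equation of `exists_unique_volterra` for
`rescale a ψ`, since `a(η₁) a(η₂)` vanishes only on a null set of the slab. -/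
lemma isSolution_iff {T : ℝ} {a : ℝ → ℝ} (ha : ∀ η, 0 < η → 0 < a η) {lam : ℂ}
    {f ψfree ψ : Config → ℂ} :
    IsSolution T a lam (singularKernel f) ψfree ψ ↔ ∀ᵐ p ∂slabMeasure T,
      Integrable (fun y : Space × Space => (kernel p y : ℂ) *
        (coefficient T a f (retardedConfig p y) * rescale a ψ (retardedConfig p y))) ∧
      rescale a ψ p = rescale a ψfree p + lam / (4 * (Real.pi : ℂ)) ^ 2 *
        potential (fun q => coefficient T a f q * rescale a ψ q) p := by
  refine Filter.eventually_congr ?_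
  filter_upwards [ae_scale_ne_zero T ha, ae_restrict_mem (measurableSet_slab T)] with p hp hpT
  rw [show integrand a (singularKernel f) ψ p = _ from funext (integrand_eq a f ψ hpT)]
  refine and_congr_right fun _ => ?_
  rw [← mul_right_inj' (mul_ne_zero hp.1 hp.2)]
  have h : (a p.1.1 : ℂ) * a p.2.1 * (ψfree p + lam / (4 * (Real.pi : ℂ)) ^ 2 *
        (1 / ((a p.1.1 : ℂ) * a p.2.1)) * potential (fun q => coefficient T a f q * rescale a ψ q) p)
      = rescale a ψfree p + lam / (4 * (Real.pi : ℂ)) ^ 2 *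
        potential (fun q => coefficient T a f q * rescale a ψ q) p := by
    have h1 := hp.1
    have h2 := hp.2
    rw [rescale]
    field_simp
  rw [← h]
  rfl

end FlatFLRW

end

theorem theorem4p2
    (T : ℝ) (hT : 0 < T)
    (a : ℝ → ℝ) (ha_cont : ContinuousOn a (Set.Ici 0)) (ha_zero : a 0 = 0)
    (ha_pos : ∀ η : ℝ, 0 < η → 0 < a η)
    (f : FlatFLRW.Config → ℂ)
    (hf_meas : MeasureTheory.AEStronglyMeasurable f FlatFLRW.halfMeasure)
    (hf_bdd : ∃ C : ℝ, ∀ p : FlatFLRW.Config, 0 ≤ p.1.1 → 0 ≤ p.2.1 → ‖f p‖ ≤ C)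
    (lam : ℂ)
    (ψfree : FlatFLRW.Config → ℂ)
    (hfree : FlatFLRW.MemB T (FlatFLRW.rescale a ψfree)) :
    ∃ ψ : FlatFLRW.Config → ℂ,
      (FlatFLRW.MemB T (FlatFLRW.rescale a ψ) ∧
        FlatFLRW.IsSolution T a lam (FlatFLRW.singularKernel f) ψfree ψ) ∧
      ∀ ψ' : FlatFLRW.Config → ℂ,
        FlatFLRW.MemB T (FlatFLRW.rescale a ψ') →
        FlatFLRW.IsSolution T a lam (FlatFLRW.singularKernel f) ψfree ψ' →
        ψ' =ᵐ[FlatFLRW.slabMeasure T] ψ := by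
  open FlatFLRW in
  -- `χ` plays the role of `a(η₁) a(η₂) ψ`.
  obtain ⟨M, hM⟩ := exists_norm_coefficient_le T ha_cont hf_bdd
  have hb := aestronglyMeasurable_coefficient T ha_cont hf_meas
  have hne := ae_scale_ne_zero T ha_pos
  obtain ⟨χ, hχ, heq, huniq⟩ := exists_unique_volterra hb coefficient_eq_zero hM
    (lam / (4 * (Real.pi : ℂ)) ^ 2) hfree.memLp
  have hbχ := memLp_mul_of_bounded hb coefficient_eq_zero hM hχ
  have hbχ0 : ∀ q ∉ slab T, coefficient T a f q * χ q = 0 := fun q hq => by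
    rw [coefficient_eq_zero q hq, zero_mul]
  have hχB : MemB T χ :=
    memB_congr (memB_add_potential hfree hbχ hbχ0 _) (Filter.EventuallyEq.symm heq)
  set ψ : Config → ℂ := fun p => χ p / ((a p.1.1 : ℂ) * (a p.2.1 : ℂ)) with hψ
  have hψχ : ∀ᵐ p ∂slabMeasure T, rescale a ψ p = χ p :=
    hne.mono fun p hp => mul_div_cancel₀ _ (mul_ne_zero hp.1 hp.2)
  have hmul : (fun q => coefficient T a f q * rescale a ψ q) =ᵐ[MeasureTheory.volume]
      fun q => coefficient T a f q * χ q := by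
    filter_upwards [(MeasureTheory.ae_restrict_iff' (measurableSet_slab T)).1 hψχ] with q hq
    by_cases hqs : q ∈ slab T
    · rw [hq hqs]
    · rw [coefficient_eq_zero q hqs, zero_mul, zero_mul]
  refine ⟨ψ, ⟨memB_congr hχB (Filter.EventuallyEq.symm hψχ), (isSolution_iff ha_pos).2 ?_⟩,
    fun ψ' hψ' hsol => ?_⟩
  · filter_upwards [heq, hψχ, ae_integrable_kernel_mul hbχ hbχ0,
      MeasureTheory.ae_restrict_of_ae (ae_ae_retardedConfig hmul),
      MeasureTheory.ae_restrict_of_ae (potential_congr_ae hmul)] with p h1 h2 h3 h4 h5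
    refine ⟨h3.congr (h4.mono fun y hy => ?_), ?_⟩
    · simp only [hy]
    · rw [h2, h5, h1]
  · have h := huniq _ hψ'.memLp (((isSolution_iff ha_pos).1 hsol).mono fun p hp => hp.2)
    filter_upwards [h, hne] with p hp hpa
    simp only [hψ, ← hp]
    exact (mul_div_cancel_left₀ _ (mul_ne_zero hpa.1 hpa.2)).symm
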